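/- Notation. Let $\mathbb{N}=\{1,2,\dots\}$ and $\mathbb{Z}_+=\{0,1,2,\dots\}$. Let $\mathbb{T}$ be the unit circle group and $\mathbb{T}_Q$ its torsion subgroup. Let $H(\mathbb{T})$ be the group of all (not necessarily continuous) group endomorphisms of $\mathbb{T}$, with the pointwise product and the topology of pointwise convergence. Let $s(k,j)$ be the signed Stirling numbers of the first kind, $X(X-1)\cdots(X-k+1)=\sum_{j}s(k,j)X^j$, and let $\alpha^{(j)}$ be the $j$-fold composition of $\alpha$ with itself. Let $\mathcal{H}\subseteq H(\mathbb{T})^{\mathbb{Z}_+}$ be the subspace of all sequences $\phi=(\phi_k)_{k\ge 0}$ with $\phi_0=\mathrm{id}_{\mathbb{T}}$ and $$\phi_k(x^{k!})=\prod_{j=1}^k\phi_1^{(j)}\big(x^{s(k,j)}\big)\qquad\text{for all }x\in\mathbb{T}_Q,\ k\in\mathbb{N}.$$ For $m \in \mathbb{N}$ let $\mathcal{H}_m\subseteq H(\mathbb{T})^{\{0,\dots,m\}}$ be the set defined by the same conditions for $k\le m$, and let $\rho_m\colon\mathcal{H}\to\mathcal{H}_m$ be the truncation $(\phi_k)_{k\ge0}\mapsto(\phi_k)_{0\le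 k\le m}$. The space $\mathcal{H}$ is a group under $(\phi\star\psi)_k=\prod_{j=0}^k\phi_{k-j}\circ\psi_j$ with identity $\tilde 0=(\mathrm{id}_{\mathbb{T}},1,1,\dots)$. Let $T\colon\mathcal{H}\to\mathcal{H}$, $T(\phi)_0=\phi_0$, $T(\phi)_k=\phi_{k-1}\phi_k$ for $k\ge1$. A system $(X,s)$ is a compact Hausdorff space $X$ with a homeomorphism $s$; its enveloping semigroup (Ellis group) $E(X,s)$ is the closure of $\{s^n:n\in\mathbb{Z}\}$ in $X^X$, with composition; a factor of $(\mathcal{H},T)$ is a system $(X,s)$ together with a continuous surjection $\pi\colon\mathcal{H}\to X$ such that $\pi\circ T=s\circ\pi$. Theorem. Let $\mathcal{G}\le\mathcal{H}$ be a subgroup for which the quotient space $\mathcal{H}/\mathcal{G}$ is Hausdorff, and let $$\mathcal{K}=\mathcal{K}_{\mathcal{G}}=\{\phi\in\mathcal{H}:\phi\star\psi\star\mathcal{G}=\psi\star\mathcal{G}\text{ for all }\psi\in\mathcal{H}\}$$ be the kernel of the action of $\mathcal{H}$ on $\mathcal{H}/\mathcal{G}$ by left translations, a normal subgroup. (i)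 If $m$ is the smallest number in $\mathbb{N}$ with $\rho_m^{-1}(\rho_m(\mathcal{G}))=\mathcal{G}$, then $\mathcal{K}=\{\phi\in\mathcal{G}:\phi_k=\tilde 0_k\text{ for all }0\le k\le m-1\}$. (ii) If $\mathcal{G}$ is a proper subset of $\rho_m^{-1}(\rho_m(\mathcal{G}))$ for every $m\in\mathbb{N}$, then $\mathcal{K}=\{\tilde 0\}$. This describes all Ellis groups of factors of $(\mathcal{H},T)$ in the following sense. For every factor $\pi\colon(\mathcal{H},T)\to(X,s)$ the set $\mathcal{G}=\pi^{-1}(\pi(\tilde 0))$ is a subgroup of $\mathcal{H}$ with Hausdorff quotient $\mathcal{H}/\mathcal{G}$, and there is a topological isomorphism $e\colon\mathcal{H}/\mathcal{K}_{\mathcal{G}}\to E(X,s)$ with $e(\phi\mathcal{K}_{\mathcal{G}})(\pi(\psi))=\pi(\phi\star\psi)$ for all $\phi,\psi\in\mathcal{H}$. Conversely, for every subgroup $\mathcal{G}\le\mathcal{H}$ with Hausdorff quotient, $\mathcal{H}/\mathcal{G}$ is compact and carries a homeomorphism $s$ with $s(\phi\star\mathcal{G})=T(\phi)\star\mathcal{G}$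 for all $\phi\in\mathcal{H}$, so that it is a factor of $(\mathcal{H},T)$ by the quotient map. -/

import Mathlib

universe u

/-! The circle group `𝕋` is Mathlib's `Circle`. -/

/-- `H(𝕋)`: the group of all (not necessarily continuous) group endomorphisms of the circle, with
the pointwise product (the `CommGroup` structure of `MonoidHom`). -/
abbrev CircleEnd : Type := Circle →* Circle

/-- `H(𝕋)` carries the topology of pointwise convergence (as a subspace of `𝕋 ^ 𝕋`). -/
noncomputable instance CircleEnd.instTopologicalSpace : TopologicalSpace CircleEnd :=
  TopologicalSpace.induced (fun (φ : CircleEnd) (x : Circle) => φ x) inferInstance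

/-- `𝕋_Q`, the group of all roots of unity, i.e. the torsion subgroup of `𝕋`. -/
noncomputable def rootsQ : Subgroup Circle := CommGroup.torsion Circle

/-- The (signed) Stirling number of the first kind `s(k, j)`: the coefficient of `X ^ j` in
`X (X - 1) ⋯ (X - k + 1)`. -/
noncomputable def stirlingS (k j : ℕ) : ℤ := (descPochhammer ℤ k).coeff j

/-- The relation `β (x ^ k!) = ∏_{j = 1}^k α^{(j)} (x ^ s(k, j))` for all `x ∈ 𝕋_Q`, where
`α^{(j)}` is the `j`-fold composition of `α` with itself. -/
def StirlingRel (k : ℕ) (α β : CircleEnd) : Prop :=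
  ∀ x ∈ rootsQ, β (x ^ k.factorial) = ∏ j ∈ Finset.Icc 1 k, (⇑α)^[j] (x ^ stirlingS k j)

/-- The space `𝓗 ⊆ H(𝕋) ^ ℤ₊`, with the topology of a subspace of the product. -/
def scrH : Set (ℕ → CircleEnd) :=
  {φ | φ 0 = MonoidHom.id Circle ∧ ∀ k, 1 ≤ k → StirlingRel k (φ 1) (φ k)}

/-- The space `𝓗_m ⊆ H(𝕋) ^ {0, …, m}`, for `m ≥ 1`. -/
def scrHm (m : ℕ) : Set (Fin (m + 1) → CircleEnd) :=
  {φ | φ 0 = MonoidHom.id Circle ∧ ∀ k : Fin (m + 1), 1 ≤ (k : ℕ) → StirlingRel k (φ 1) (φ k)}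

/-- The truncation map `ρ_m : 𝓗 → 𝓗_m`. -/
def rho (m : ℕ) (φ : scrH) : scrHm m :=
  ⟨fun k => φ.1 k, by
    refine ⟨φ.2.1, fun k hk => ?_⟩
    have hm : ((1 : Fin (m + 1)) : ℕ) = 1 := by
      have := k.2
      obtain ⟨n, rfl⟩ : ∃ n, m = n + 1 := ⟨m - 1, by omega⟩
      rfl
    simpa only [hm] using φ.2.2 k hk⟩

/-- The sequence `0̃ = (id, 1, 1, …)`. -/
noncomputable def zeroTilde : ℕ → CircleEnd
  | 0 => MonoidHom.id Circle
  | _ + 1 => 1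

/-- The operation `(φ ⋆ ψ)_k = ∏_{j = 0}^k φ_{k - j} ∘ ψ_j`. -/
noncomputable def starProd (φ ψ : ℕ → CircleEnd) (k : ℕ) : CircleEnd :=
  ∏ j ∈ Finset.range (k + 1), (φ (k - j)).comp (ψ j)

/-- The map `A_G (g₀, g₁, g₂, …) = (g₀, g₀ g₁, g₁ g₂, …)` on `G ^ ℤ₊`. -/
def shiftA {G : Type*} [Mul G] (g : ℕ → G) : ℕ → G
  | 0 => g 0
  | k + 1 => g k * g (k + 1)

/-! ### `𝓗` is closed under `⋆` and is a group -/

namespace ScrH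

lemma exists_zpow (α : CircleEnd) {N : ℕ} (hN : 0 < N) :
    ∃ n : ℤ, ∀ x : Circle, x ^ N = 1 → α x = x ^ n := by
  have key : ∀ x : Circle, x ^ N = 1 →
      ∃ a : ℤ, x = (Circle.exp (2 * Real.pi / N)) ^ a := by
    intro x hx
    obtain ⟨θ, rfl⟩ := Circle.exp_surjective x
    rw [← Circle.exp_nsmul, Circle.exp_eq_one] at hx
    obtain ⟨a, ha⟩ := hx
    refine ⟨a, ?_⟩
    rw [← Circle.exp_zsmul]
    congr 1
    have : (N : ℝ) ≠ 0 := by positivity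
    simp only [nsmul_eq_mul, zsmul_eq_mul] at ha ⊢
    field_simp
    linarith
  have hζ : (Circle.exp (2 * Real.pi / N)) ^ N = 1 := by
    rw [← Circle.exp_nsmul, Circle.exp_eq_one]
    refine ⟨1, ?_⟩
    have : (N : ℝ) ≠ 0 := by positivity
    simp only [nsmul_eq_mul]
    field_simp
    simp
  obtain ⟨n, hn⟩ := key (α (Circle.exp (2 * Real.pi / N))) (by rw [← map_pow, hζ, map_one])
  refine ⟨n, fun x hx => ?_⟩
  obtain ⟨a, rfl⟩ := key x hx
  rw [map_zpow, hn, ← zpow_mul, ← zpow_mul, mul_comm n a]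

lemma exists_root (x : Circle) {k : ℕ} (hk : 0 < k) : ∃ y : Circle, y ^ k = x := by
  obtain ⟨θ, rfl⟩ := Circle.exp_surjective x
  refine ⟨Circle.exp (θ / k), ?_⟩
  rw [← Circle.exp_nsmul]
  congr 1
  have : (k : ℝ) ≠ 0 := by positivity
  simp only [nsmul_eq_mul]
  field_simp

lemma stirling_sum (n : ℤ) {k : ℕ} (hk : 1 ≤ k) :
    ∑ j ∈ Finset.Icc 1 k, n ^ j * stirlingS k j = k.factorial * Ring.choose n k := by
  have h1 : (descPochhammer ℤ k).eval n = k.factorial * Ring.choose n k := by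
    have := Ring.descPochhammer_eq_factorial_smul_choose n k
    rw [nsmul_eq_mul] at this
    rw [← this, Polynomial.eval_eq_smeval]
  rw [← h1, Polynomial.eval_eq_sum_range, descPochhammer_natDegree, Finset.sum_range_succ']
  have h0 : (descPochhammer ℤ k).coeff 0 = 0 := by
    obtain ⟨l, rfl⟩ : ∃ l, k = l + 1 := ⟨k - 1, by omega⟩
    rw [descPochhammer_succ_left, Polynomial.mul_coeff_zero]
    simp
  rw [h0, zero_mul, add_zero, ← Finset.sum_image (s := Finset.range k) (g := fun i => i + 1)
    (f := fun i => (descPochhammer ℤ k).coeff i * n ^ i) (by intro a _ b _; simp)]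
  have : (Finset.range k).image (fun i => i + 1) = Finset.Icc 1 k := by
    ext j
    simp only [Finset.mem_image, Finset.mem_range, Finset.mem_Icc]
    constructor
    · rintro ⟨a, ha, rfl⟩; omega
    · rintro ⟨h, h'⟩; exact ⟨j - 1, by omega, by omega⟩
  rw [this]
  exact Finset.sum_congr rfl fun j _ => mul_comm _ _

lemma prod_zpow_sum {ι : Type*} (s : Finset ι) (f : ι → ℤ) (x : Circle) :
    ∏ i ∈ s, x ^ f i = x ^ ∑ i ∈ s, f i := by
  classical
  induction s using Finset.induction_on with
  | empty => simp
  | insert a s ha ih => rw [Finset.prod_insert ha, Finset.sum_insert ha, ih, zpow_add]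

lemma iterate_zpow {α : CircleEnd} {N : ℕ} {n : ℤ} (h : ∀ x : Circle, x ^ N = 1 → α x = x ^ n)
    (j : ℕ) (x : Circle) (hx : x ^ N = 1) : (⇑α)^[j] x = x ^ (n ^ j) := by
  induction j with
  | zero => simp
  | succ j ih =>
    rw [Function.iterate_succ_apply', ih, map_zpow, h x hx, ← zpow_mul, pow_succ, mul_comm]

lemma prod_stirling {α : CircleEnd} {N : ℕ} {n : ℤ} (h : ∀ x : Circle, x ^ N = 1 → α x = x ^ n)
    {k : ℕ} (hk : 1 ≤ k) (x : Circle) (hx : x ^ N = 1) :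
    ∏ j ∈ Finset.Icc 1 k, (⇑α)^[j] (x ^ stirlingS k j) = (x ^ k.factorial) ^ Ring.choose n k := by
  have : ∀ j ∈ Finset.Icc 1 k, (⇑α)^[j] (x ^ stirlingS k j) = x ^ (n ^ j * stirlingS k j) := by
    intro j _
    rw [iterate_zpow h j _ (by rw [← zpow_natCast, zpow_comm, zpow_natCast, hx, one_zpow]),
      ← zpow_mul, mul_comm]
  rw [Finset.prod_congr rfl this, prod_zpow_sum, stirling_sum n hk, zpow_mul,
    zpow_natCast]

lemma pow_zpow_eq_one {x : Circle} {N : ℕ} (hx : x ^ N = 1) (n : ℤ) : (x ^ n) ^ N = 1 := by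
  rw [← zpow_natCast, zpow_comm, zpow_natCast, hx, one_zpow]

lemma mem_iff {φ : ℕ → CircleEnd} :
    φ ∈ scrH ↔ φ 0 = MonoidHom.id Circle ∧ ∀ K N : ℕ, 0 < N →
      ∃ n : ℤ, ∀ k ≤ K, ∀ x : Circle, x ^ N = 1 → φ k x = x ^ Ring.choose n k := by
  constructor
  · rintro ⟨h0, h⟩
    refine ⟨h0, fun K N hN => ?_⟩
    obtain ⟨n, hn⟩ := exists_zpow (φ 1) (Nat.mul_pos hN (Nat.factorial_pos K))
    refine ⟨n, fun k hk x hx => ?_⟩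
    rcases Nat.eq_zero_or_pos k with rfl | hk0
    · simp [h0]
    obtain ⟨y, rfl⟩ := exists_root x (Nat.factorial_pos k)
    have hy : y ^ (N * K.factorial) = 1 := by
      obtain ⟨c, hc⟩ := Nat.factorial_dvd_factorial hk
      rw [hc, show N * (k.factorial * c) = k.factorial * N * c by ring, pow_mul, pow_mul, hx,
        one_pow]
    have hyQ : y ∈ rootsQ :=
      isOfFinOrder_iff_pow_eq_one.2 ⟨_, Nat.mul_pos hN (Nat.factorial_pos K), hy⟩
    rw [h k hk0 y hyQ, prod_stirling hn hk0 y hy]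
  · rintro ⟨h0, h⟩
    refine ⟨h0, fun k hk x hx => ?_⟩
    obtain ⟨N, hN, hxN⟩ := isOfFinOrder_iff_pow_eq_one.1 hx
    obtain ⟨n, hn⟩ := h k N hN
    have h1 : ∀ y : Circle, y ^ N = 1 → φ 1 y = y ^ n := by
      intro y hy
      simpa using hn 1 hk y hy
    rw [prod_stirling h1 hk x hxN, hn k le_rfl]
    rw [← pow_mul, mul_comm, pow_mul, hxN, one_pow]

lemma starProd_apply (φ ψ : ℕ → CircleEnd) (k : ℕ) (x : Circle) :
    starProd φ ψ k x = ∏ j ∈ Finset.range (k + 1), φ (k - j) (ψ j x) := by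
  simp [starProd, MonoidHom.finsetProd_apply]

lemma choose_add (m n : ℤ) (k : ℕ) :
    ∑ j ∈ Finset.range (k + 1), Ring.choose m j * Ring.choose n (k - j) =
      Ring.choose (m + n) k := by
  rw [Ring.add_choose_eq k (Commute.all m n),
    Finset.Nat.sum_antidiagonal_eq_sum_range_succ (fun i j => Ring.choose m i * Ring.choose n j)]

lemma starProd_mem {φ ψ : ℕ → CircleEnd} (hφ : φ ∈ scrH) (hψ : ψ ∈ scrH) :
    starProd φ ψ ∈ scrH := by
  rw [mem_iff] at *
  refine ⟨?_, fun K N hN => ?_⟩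
  · ext x
    simp [starProd_apply, hφ.1, hψ.1]
  · obtain ⟨n, hn⟩ := hφ.2 K N hN
    obtain ⟨m, hm⟩ := hψ.2 K N hN
    refine ⟨m + n, fun k hk x hx => ?_⟩
    rw [starProd_apply, ← choose_add, ← prod_zpow_sum]
    refine Finset.prod_congr rfl fun j hj => ?_
    have hj' := Finset.mem_range.1 hj
    rw [hm j (by omega) x hx, hn (k - j) (by omega) _ (pow_zpow_eq_one hx _), ← zpow_mul]

lemma zeroTilde_mem : zeroTilde ∈ scrH := by
  rw [mem_iff]
  refine ⟨rfl, fun K N _ => ⟨0, fun k _ x _ => ?_⟩⟩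
  cases k with
  | zero => simp [zeroTilde]
  | succ k => simp [zeroTilde, Ring.choose_zero_succ]

/-- The left inverse with respect to `⋆`. -/
noncomputable def invSeq (φ : ℕ → CircleEnd) : ℕ → CircleEnd
  | 0 => MonoidHom.id Circle
  | k + 1 => (∏ j : Fin (k + 1), (invSeq φ (k - j)).comp (φ (j + 1)))⁻¹
decreasing_by omega

lemma invSeq_starProd {φ : ℕ → CircleEnd} (h0 : φ 0 = MonoidHom.id Circle) :
    starProd (invSeq φ) φ = zeroTilde := by
  funext k
  cases k with
  | zero => simp [starProd, h0, invSeq, zeroTilde]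
  | succ k =>
    rw [starProd, Finset.prod_range_succ', h0, Nat.sub_zero, MonoidHom.comp_id, invSeq,
      ← Fin.prod_univ_eq_prod_range
        (fun j => (invSeq φ (k + 1 - (j + 1))).comp (φ (j + 1))) (k + 1)]
    simp only [Nat.add_sub_add_right]
    exact mul_inv_cancel _

lemma invSeq_mem {φ : ℕ → CircleEnd} (hφ : φ ∈ scrH) : invSeq φ ∈ scrH := by
  have hinv := invSeq_starProd hφ.1
  rw [mem_iff] at *
  refine ⟨by rw [invSeq], fun K N hN => ?_⟩
  obtain ⟨n, hn⟩ := hφ.2 K N hN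
  refine ⟨-n, fun k => ?_⟩
  induction k using Nat.strong_induction_on with
  | _ k ih =>
    intro hk x hx
    cases k with
    | zero => simp [invSeq]
    | succ k =>
      have h1 : starProd (invSeq φ) φ (k + 1) x = 1 := by rw [hinv]; rfl
      have h2 := choose_add n (-n) (k + 1)
      rw [add_neg_cancel, Ring.choose_zero_succ, Finset.sum_range_succ'] at h2
      rw [starProd_apply, Finset.prod_range_succ'] at h1
      have h3 : ∀ j ∈ Finset.range (k + 1), invSeq φ (k + 1 - (j + 1)) (φ (j + 1) x) =
          x ^ (Ring.choose n (j + 1) * Ring.choose (-n) (k + 1 - (j + 1))) := by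
        intro j hj
        have hj' := Finset.mem_range.1 hj
        rw [hn (j + 1) (by omega) x hx,
          ih (k + 1 - (j + 1)) (by omega) (by omega) _ (pow_zpow_eq_one hx _), ← zpow_mul]
      rw [Finset.prod_congr rfl h3, prod_zpow_sum, hφ.1] at h1
      simp only [Ring.choose_zero_right, one_mul, Nat.sub_zero] at h2
      rw [eq_neg_of_add_eq_zero_left h2, zpow_neg, MonoidHom.id_apply, Nat.sub_zero,
        inv_mul_eq_one] at h1
      exact h1.symm

lemma starProd_assoc (a b c : ℕ → CircleEnd) :
    starProd (starProd a b) c = starProd a (starProd b c) := by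
  funext k
  ext1 x
  have h1 : starProd (starProd a b) c k x = ∏ j ∈ Finset.range (k + 1),
      ∏ i ∈ Finset.range (k + 1 - j), a (k - j - i) (b i (c j x)) := by
    rw [starProd_apply]
    refine Finset.prod_congr rfl fun j hj => ?_
    have hj' := Finset.mem_range.1 hj
    rw [starProd_apply, show k - j + 1 = k + 1 - j by omega]
  have h2 : starProd a (starProd b c) k x = ∏ l ∈ Finset.range (k + 1),
      ∏ j ∈ Finset.range (l + 1), a (k - j - (l - j)) (b (l - j) (c j x)) := by
    rw [starProd_apply]
    refine Finset.prod_congr rfl fun l hl => ?_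
    rw [starProd_apply, map_prod]
    refine Finset.prod_congr rfl fun j hj => ?_
    have hj' := Finset.mem_range.1 hj
    rw [show k - j - (l - j) = k - l by omega]
  rw [h1, h2, Finset.prod_range_diag_flip (k + 1) (fun j i => a (k - j - i) (b i (c j x)))]

lemma zeroTilde_starProd (a : ℕ → CircleEnd) : starProd zeroTilde a = a := by
  funext k
  ext1 x
  rw [starProd_apply, Finset.prod_range_succ, Nat.sub_self]
  rw [Finset.prod_eq_one, one_mul]
  · rfl
  · intro j hj
    have hj' := Finset.mem_range.1 hj
    obtain ⟨i, hi⟩ : ∃ i, k - j = i + 1 := ⟨k - j - 1, by omega⟩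
    rw [hi]
    rfl

end ScrH

/-- The group `(𝓗, ⋆)`, with identity element `0̃`. -/
noncomputable instance ScrH.instGroup : Group scrH :=
  letI : Mul scrH := ⟨fun φ ψ => ⟨starProd φ.1 ψ.1, ScrH.starProd_mem φ.2 ψ.2⟩⟩
  letI : One scrH := ⟨⟨zeroTilde, ScrH.zeroTilde_mem⟩⟩
  letI : Inv scrH := ⟨fun φ => ⟨ScrH.invSeq φ.1, ScrH.invSeq_mem φ.2⟩⟩
  Group.ofLeftAxioms
    (fun a b c => Subtype.ext (ScrH.starProd_assoc a.1 b.1 c.1))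
    (fun a => Subtype.ext (ScrH.zeroTilde_starProd a.1))
    (fun a => Subtype.ext (ScrH.invSeq_starProd a.2.1))

lemma ScrH.coe_mul (φ ψ : scrH) : (φ * ψ).1 = starProd φ.1 ψ.1 := rfl

lemma ScrH.coe_one : (1 : scrH).1 = zeroTilde := rfl

lemma ScrH.shiftA_mem {φ : ℕ → CircleEnd} (hφ : φ ∈ scrH) : shiftA φ ∈ scrH := by
  rw [ScrH.mem_iff] at *
  refine ⟨hφ.1, fun K N hN => ?_⟩
  obtain ⟨n, hn⟩ := hφ.2 K N hN
  refine ⟨n + 1, fun k hk x hx => ?_⟩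
  cases k with
  | zero => simp [shiftA, hφ.1]
  | succ k =>
    rw [shiftA, MonoidHom.mul_apply, hn k (by omega) x hx, hn (k + 1) hk x hx, ← zpow_add,
      Ring.choose_succ_succ]

/-- The homeomorphism `T` of the system `(𝓗, T)`: the restriction to `𝓗` of `A_{H(𝕋)}`. -/
noncomputable def shiftT (φ : scrH) : scrH := ⟨shiftA φ.1, ScrH.shiftA_mem φ.2⟩

/-- The kernel `𝓚` of the action of `𝓗` on `𝓗 / 𝓖` by left translations, i.e. the set of all `φ`
with `φ ⋆ ψ ⋆ 𝓖 = ψ ⋆ 𝓖` for all `ψ`; a normal subgroup of `𝓗`. -/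
noncomputable abbrev actionKernel (G : Subgroup scrH) : Subgroup scrH :=
  (MulAction.toPermHom scrH (scrH ⧸ G)).ker

lemma mem_actionKernel {G : Subgroup scrH} {φ : scrH} :
    φ ∈ actionKernel G ↔ ∀ ψ : scrH, ((φ * ψ : scrH) : scrH ⧸ G) = (ψ : scrH ⧸ G) := by
  rw [MonoidHom.mem_ker, Equiv.ext_iff]
  constructor
  · intro h ψ
    exact h (ψ : scrH ⧸ G)
  · intro h q
    induction q using QuotientGroup.induction_on with
    | H ψ => exact h ψ

/-- The enveloping semigroup (Ellis group, for a distal system) `E(X, s)`: the closure of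
`{s ^ n : n ∈ ℤ}` in `X ^ X`, with the topology of pointwise convergence. -/
def envelopingSemigroup {X : Type*} [TopologicalSpace X] (s : X ≃ₜ X) : Set (X → X) :=
  closure (Set.range fun n : ℤ => ⇑(s ^ n))

/-! Filter `scrH` by the kernels `trunc n` of the truncations. The first coordinate in which an
element differs from `0̃` is its leading coefficient, and leading coefficients multiply like
endomorphisms of the circle. For `φ ∈ trunc r` and `ψ ∈ trunc j` the commutator lies one level
deeper than expected, in `trunc (r + j + 1)`, and its leading coefficient compares `φ_{r+1} ∘
ψ_{j+1}` with `ψ_{j+1} ∘ φ_{r+1}` (`commutator_lead`).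

`CircleEnd` is the compact dual of the discrete circle, so a closed subgroup is determined by its
annihilator (`mem_of_annihilator`). Hence the commutators of one non-power map with all maps trivial
on torsion generate a dense subgroup of a group containing every map trivial on torsion
(`mem_of_commutators`). Every level beyond the first has only such coefficients. Consequently a
closed normal subgroup with a nontrivial leading coefficient at level `r + 1` contains `trunc (r +
1)` (`trunc_le_of_normal`).

The action kernel is closed, normal and contained in `G`. An element of it outside `trunc (m - 1)`
would force some `trunc k ≤ G` with `1 ≤ k < m`, against minimality; conversely, conjugating an
element of `G ∩ trunc (m - 1)` changes it only by an element of `trunc m ≤ G`.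

For factors, `T` is left translation by `T 0̃`, and the same commutator argument makes the powers of
`T 0̃` dense (`dense_orbit`). Right translations are continuous, so identities checked on these
powers extend to all of `scrH`, and `scrH` acts on each factor with image exactly the Ellis group.
-/

open MeasureTheory Topology Filter

/-! ### Duality for closed subgroups of `H(𝕋)` -/

namespace CircleEnd

instance : T2Space CircleEnd :=
  (Topology.IsEmbedding.mk ⟨rfl⟩ DFunLike.coe_injective :
    IsEmbedding (fun (φ : CircleEnd) (x : Circle) => φ x)).t2Space

lemma continuous_apply (x : Circle) : Continuous fun φ : CircleEnd => φ x :=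
  (_root_.continuous_apply x).comp continuous_induced_dom

lemma continuous_iff {Y : Type*} [TopologicalSpace Y] {f : Y → CircleEnd} :
    Continuous f ↔ ∀ x, Continuous fun y => f y x := by
  rw [continuous_induced_rng, continuous_pi_iff]
  rfl

instance : IsTopologicalGroup CircleEnd where
  continuous_mul := continuous_iff.2 fun x =>
    ((continuous_apply x).comp continuous_fst).mul ((continuous_apply x).comp continuous_snd)
  continuous_inv := continuous_iff.2 fun x => (continuous_apply x).inv

instance : CompactSpace CircleEnd := by
  have h : IsClosedEmbedding (fun (φ : CircleEnd) (x : Circle) => φ x) := by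
    refine ⟨⟨⟨rfl⟩, DFunLike.coe_injective⟩, ?_⟩
    have : Set.range (fun (φ : CircleEnd) (x : Circle) => φ x) =
        ⋂ x, ⋂ y, {f : Circle → Circle | f (x * y) = f x * f y} := by
      ext f
      simp only [Set.mem_range, Set.mem_iInter, Set.mem_ofPred_eq]
      constructor
      · rintro ⟨φ, rfl⟩ x y
        exact map_mul φ x y
      · intro h
        exact ⟨MonoidHom.mk' f h, rfl⟩
    rw [this]
    exact isClosed_iInter fun x => isClosed_iInter fun y => isClosed_eq
      (_root_.continuous_apply _) (by fun_prop)
  exact h.compactSpace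

/-- Evaluation at a point of the circle, as a multiplicative family of continuous functions. -/
noncomputable def evalC : Circle →* C(CircleEnd, ℂ) where
  toFun x := ⟨fun φ => (φ x : ℂ), continuous_subtype_val.comp (continuous_apply x)⟩
  map_one' := by ext φ; simp
  map_mul' x y := by ext φ; simp

lemma evalC_apply (x : Circle) (φ : CircleEnd) : evalC x φ = (φ x : ℂ) := rfl

/-- The star subalgebra generated by the evaluations. -/
noncomputable def evalSubalgebra : StarSubalgebra ℂ C(CircleEnd, ℂ) where
  toSubalgebra := Algebra.adjoin ℂ (Set.range evalC)
  star_mem' := by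
    change Algebra.adjoin ℂ (Set.range evalC) ≤ star (Algebra.adjoin ℂ (Set.range evalC))
    refine Algebra.adjoin_le ?_
    rintro - ⟨x, rfl⟩
    refine Algebra.subset_adjoin ⟨x⁻¹, ?_⟩
    ext φ
    simp [evalC_apply, ← Circle.coe_inv_eq_conj]

lemma evalSubalgebra_closure : evalSubalgebra.topologicalClosure = ⊤ := by
  refine ContinuousMap.starSubalgebra_topologicalClosure_eq_top_of_separatesPoints _ ?_
  intro φ ψ h
  obtain ⟨x, hx⟩ := DFunLike.ne_iff.1 h
  exact ⟨_, ⟨evalC x, Algebra.subset_adjoin ⟨x, rfl⟩, rfl⟩, fun h' => hx (Circle.ext h')⟩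

/-- Products of evaluations are again evaluations, so the generated algebra needs only linear
combinations. -/
lemma evalSubalgebra_eq_span (f : C(CircleEnd, ℂ)) (hf : f ∈ evalSubalgebra) :
    f ∈ Submodule.span ℂ (Set.range evalC) := by
  have h : Subalgebra.toSubmodule (Algebra.adjoin ℂ (Set.range evalC)) =
      Submodule.span ℂ (Set.range evalC) := by
    rw [Algebra.adjoin_eq_span]
    congr 1
    have := Submonoid.closure_eq (MonoidHom.mrange evalC)
    rwa [SetLike.ext'_iff] at this
  rw [← h]
  exact hf

/-- Duality: a closed subgroup of `H(𝕋)` is determined by its annihilator. -/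
theorem mem_of_annihilator (B : Subgroup CircleEnd) (hB : IsClosed (B : Set CircleEnd))
    (α : CircleEnd) (h : ∀ x, (∀ b ∈ B, b x = 1) → α x = 1) : α ∈ B := by
  by_contra hα
  let : MeasurableSpace B := borel B
  have : BorelSpace B := ⟨rfl⟩
  have : CompactSpace B := isCompact_iff_compactSpace.1 hB.isCompact
  let μ : Measure B := Measure.haar
  have hint : ∀ f : C(CircleEnd, ℂ), ∀ β : CircleEnd,
      Integrable (fun b : B => f (β * b.1)) μ := by
    intro f β
    refine Continuous.integrable_of_hasCompactSupport (by fun_prop) ?_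
    exact HasCompactSupport.of_compactSpace _
  have hcont : ∀ β : CircleEnd, Continuous fun f : C(CircleEnd, ℂ) => ∫ b : B, f (β * b.1) ∂μ := by
    intro β
    refine (LipschitzWith.of_dist_le_mul (K := (μ.real Set.univ).toNNReal)
      fun f g => ?_).continuous
    rw [dist_eq_norm, ← integral_sub (hint f β) (hint g β), Real.coe_toNNReal _ measureReal_nonneg, mul_comm]
    exact norm_integral_le_of_norm_le_const
      (Eventually.of_forall fun b => by rw [← dist_eq_norm]; exact ContinuousMap.dist_apply_le_dist _)
  -- Haar measure on `B` and its translate by `α` have the same integrals. For the evaluation at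
  -- `x`, either `x` annihilates `B`, hence `α`, or both integrals vanish by invariance. Linearity
  -- and Stone–Weierstrass give the rest.
  have heq : ∀ f : C(CircleEnd, ℂ), ∫ b : B, f (α * b.1) ∂μ = ∫ b : B, f (1 * b.1) ∂μ := by
    have hcl : IsClosed {f : C(CircleEnd, ℂ) |
        ∫ b : B, f (α * b.1) ∂μ = ∫ b : B, f (1 * b.1) ∂μ} := isClosed_eq (hcont α) (hcont 1)
    have hsub : (evalSubalgebra : Set C(CircleEnd, ℂ)) ⊆ {f : C(CircleEnd, ℂ) |
        ∫ b : B, f (α * b.1) ∂μ = ∫ b : B, f (1 * b.1) ∂μ} := by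
      intro f hf
      replace hf := evalSubalgebra_eq_span f hf
      induction hf using Submodule.span_induction with
      | mem f hf =>
        obtain ⟨x, rfl⟩ := hf
        simp only [Set.mem_ofPred_eq, evalC_apply, MonoidHom.mul_apply, Circle.coe_mul,
          one_mul, integral_const_mul]
        by_cases hx : ∀ b ∈ B, b x = 1
        · rw [h x hx, Circle.coe_one, one_mul]
        · push Not at hx
          obtain ⟨c, hc, hcx⟩ := hx
          have h1 : ∫ b : B, (b.1 x : ℂ) ∂μ = ∫ b : B, (c x : ℂ) * (b.1 x : ℂ) ∂μ := by
            have := integral_mul_left_eq_self (μ := μ) (fun b : B => (b.1 x : ℂ)) ⟨c, hc⟩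
            rw [← this]
            simp
          rw [integral_const_mul] at h1
          have h2 : ∫ b : B, (b.1 x : ℂ) ∂μ = 0 := by
            by_contra h0
            apply hcx
            apply Circle.ext
            rw [Circle.coe_one]
            exact (mul_right_cancel₀ h0 ((one_mul _).trans h1)).symm
          rw [h2, mul_zero]
      | zero => simp
      | add f g _ _ hf hg =>
        simp only [Set.mem_ofPred_eq, ContinuousMap.add_apply] at hf hg ⊢
        rw [integral_add (hint f _) (hint g _), integral_add (hint f _) (hint g _)]
        exact congrArg₂ _ hf hg
      | smul c f _ hf =>
        simp only [Set.mem_ofPred_eq, ContinuousMap.smul_apply] at hf ⊢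
        rw [integral_smul, integral_smul]
        exact congrArg _ hf
    intro f
    have hf : f ∈ evalSubalgebra.topologicalClosure := by
      rw [evalSubalgebra_closure]; trivial
    exact hcl.closure_subset_iff.2 hsub hf
  -- The cosets `B` and `αB` are disjoint and closed; a Urysohn function separating them has
  -- different integrals against the two measures.
  obtain ⟨f, hf0, hf1, -⟩ := exists_continuous_zero_one_of_isClosed hB
    (hB.preimage (continuous_const_mul α⁻¹)) (by
      rw [Set.disjoint_left]
      intro b hb hb'
      have : α⁻¹ * b ∈ B := hb'
      exact hα (inv_mem_iff.1 ((Subgroup.mul_mem_cancel_right B hb).1 this)))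
  have key := heq ⟨fun φ => (f φ : ℂ), by fun_prop⟩
  have e1 : ∀ b : B, f (α * b.1) = 1 := fun b => hf1 (by
    change α⁻¹ * (α * b.1) ∈ B
    rw [inv_mul_cancel_left]; exact b.2)
  have e0 : ∀ b : B, f (1 * b.1) = 0 := fun b => hf0 (by rw [one_mul]; exact b.2)
  simp only [ContinuousMap.coe_mk, e1, e0] at key
  simp only [Complex.ofReal_one, Complex.ofReal_zero, integral_const,
    Complex.real_smul, mul_one, mul_zero, Complex.ofReal_eq_zero] at key
  exact NeZero.ne μ (Measure.measure_univ_eq_zero.1 ((measureReal_eq_zero_iff (μ := μ)).1 key))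

/-! ### Circle-valued characters and power maps -/

noncomputable instance : DivisibleBy (Additive Circle) ℤ :=
  divisibleByOfSMulRightSurj (Additive Circle) ℤ fun {n} hn x => by
    obtain ⟨y, hy⟩ := ScrH.exists_root x.toMul (Int.natAbs_pos.2 hn)
    rcases Int.natAbs_eq n with h | h
    · refine ⟨Additive.ofMul y, ?_⟩
      change Additive.ofMul (y ^ n) = x
      rw [h, zpow_natCast, hy]
      rfl
    · refine ⟨Additive.ofMul y⁻¹, ?_⟩
      change Additive.ofMul (y⁻¹ ^ n) = x
      rw [h, zpow_neg, zpow_natCast, inv_pow, inv_inv, hy]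
      rfl

/-- Characters with prescribed value at an element of infinite order. -/
lemma exists_character_eq {Γ : Type} [CommGroup Γ] {z : Γ} (hz : ∀ n : ℤ, z ^ n = 1 → n = 0)
    (t : Circle) : ∃ c : Γ →* Circle, c z = t := by
  obtain ⟨h, hh⟩ := (Module.Baer.of_divisible (Additive Circle)).extension_property_addMonoidHom
    (zmultiplesHom (Additive Γ) (Additive.ofMul z))
    ((injective_iff_map_eq_zero _).2 fun n hn => hz n hn)
    (zmultiplesHom (Additive Circle) (Additive.ofMul t))
  refine ⟨AddMonoidHom.toMultiplicative h, ?_⟩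
  have := DFunLike.congr_fun hh 1
  simp only [AddMonoidHom.comp_apply, zmultiplesHom_apply, one_zsmul] at this
  exact this

/-- The embedding of `ℚ / ℤ` into the circle. -/
lemma exists_rat_embedding :
    ∃ f : AddCircle (1 : ℚ) →+ Additive Circle, Function.Injective f := by
  let g : AddCircle (1 : ℚ) →+ AddCircle (1 : ℝ) :=
    QuotientAddGroup.map _ _ (Rat.castHom ℝ).toAddMonoidHom (by
      intro q hq
      obtain ⟨n, rfl⟩ := AddSubgroup.mem_zmultiples_iff.1 hq
      exact AddSubgroup.mem_zmultiples_iff.2 ⟨n, by simp⟩)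
  have hg : Function.Injective g := by
    refine (injective_iff_map_eq_zero _).2 fun a ha => ?_
    induction a using QuotientAddGroup.induction_on with
    | H q =>
      have ha : ((q : ℝ) : AddCircle (1 : ℝ)) = 0 := ha
      obtain ⟨n, hn⟩ := (AddCircle.coe_eq_zero_iff (1 : ℝ)).1 ha
      refine (AddCircle.coe_eq_zero_iff (1 : ℚ)).2 ⟨n, ?_⟩
      simp only [zsmul_eq_mul, mul_one] at hn ⊢
      exact_mod_cast hn
  let e : AddCircle (1 : ℝ) →+ Additive Circle :=
    AddMonoidHom.mk' (fun x => Additive.ofMul x.toCircle) fun x y => by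
      rw [AddCircle.toCircle_add]; rfl
  exact ⟨e.comp g, (AddCircle.injective_toCircle one_ne_zero).comp hg⟩

lemma exists_character_ne_one {Γ : Type} [CommGroup Γ] {z : Γ} (hz : z ≠ 1) :
    ∃ c : Γ →* Circle, c z ≠ 1 := by
  obtain ⟨c, hc⟩ := CharacterModule.exists_character_apply_ne_zero_of_ne_zero
    (A := Additive Γ) (a := Additive.ofMul z) hz
  obtain ⟨f, hf⟩ := exists_rat_embedding
  refine ⟨AddMonoidHom.toMultiplicative (f.comp c), fun h => hc ?_⟩
  exact (injective_iff_map_eq_zero f).1 hf _ h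

/-- The image of `x` in `Circle ⧸ rootsQ` has infinite order, so a character of the quotient may
take any value there. -/
lemma exists_torsionFree_eq {x : Circle} (hx : x ∉ rootsQ) (t : Circle) :
    ∃ θ : CircleEnd, rootsQ ≤ θ.ker ∧ θ x = t := by
  obtain ⟨c, hc⟩ := exists_character_eq (Γ := Circle ⧸ rootsQ) (z := (x : Circle ⧸ rootsQ))
    (fun n hn => by
      by_contra h0
      rw [← QuotientGroup.mk_zpow, QuotientGroup.eq_one_iff] at hn
      obtain ⟨m, hm, h⟩ := isOfFinOrder_iff_pow_eq_one.1 hn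
      rw [← zpow_natCast, ← zpow_mul] at h
      exact hx (isOfFinOrder_iff_zpow_eq_one.2 ⟨_, mul_ne_zero h0 (by omega), h⟩)) t
  refine ⟨c.comp (QuotientGroup.mk' rootsQ), fun y hy => ?_, hc⟩
  rw [MonoidHom.mem_ker, MonoidHom.comp_apply, QuotientGroup.mk'_apply,
    (QuotientGroup.eq_one_iff y).2 hy, map_one]

lemma exists_notMem_rootsQ : ∃ x : Circle, x ∉ rootsQ := by
  refine ⟨Circle.exp 1, fun h => ?_⟩
  obtain ⟨n, hn, h⟩ := isOfFinOrder_iff_pow_eq_one.1 h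
  rw [← Circle.exp_nsmul, Circle.exp_eq_one] at h
  obtain ⟨a, ha⟩ := h
  simp only [nsmul_eq_mul, mul_one] at ha
  have ha0 : a ≠ 0 := by
    rintro rfl
    simp at ha
    omega
  refine irrational_pi ⟨n / (2 * a), ?_⟩
  have : (a : ℝ) ≠ 0 := by exact_mod_cast ha0
  push_cast
  rw [ha]
  field_simp

/-- `f` is not a power map. -/
def NotPower (f : CircleEnd) : Prop := ∀ n : ℤ, ∃ x, f x ≠ x ^ n

lemma eq_one_of_zpow {f : CircleEnd} (hf : rootsQ ≤ f.ker) {n : ℤ} (h : ∀ x, f x = x ^ n) :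
    f = 1 := by
  have hn : n = 0 := by
    by_contra h0
    -- A root of unity of exact order `2|n|` is not killed by the `n`-th power map, whereas `f`
    -- kills all torsion.
    obtain ⟨ζ, hζ⟩ : ∃ ζ : Circle, IsPrimitiveRoot ζ (2 * n.natAbs) := by
      refine ⟨Circle.exp (2 * Real.pi / (2 * n.natAbs : ℕ)), ?_⟩
      have := Complex.isPrimitiveRoot_exp (2 * n.natAbs) (by omega)
      refine IsPrimitiveRoot.of_map_of_injective (f := Circle.coeHom) ?_ Subtype.val_injective
      convert this using 1
      change ((Circle.exp _ : Circle) : ℂ) = _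
      rw [Circle.coe_exp]
      congr 1
      push_cast
      ring
    have h1 : ζ ∈ rootsQ := isOfFinOrder_iff_pow_eq_one.2 ⟨_, by omega, hζ.pow_eq_one⟩
    have h2 : ζ ^ n = 1 := by rw [← h]; exact hf h1
    have h3 := (hζ.zpow_eq_one_iff_dvd n).1 h2
    have h4 := Int.natAbs_dvd_natAbs.2 h3
    have h5 := Nat.le_of_dvd (by omega) h4
    omega
  ext x
  simp [h, hn]

lemma notPower_of_rootsQ_le {f : CircleEnd} (hf : rootsQ ≤ f.ker) (h1 : f ≠ 1) : NotPower f := by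
  intro n
  by_contra h
  push Not at h
  exact h1 (eq_one_of_zpow hf h)

/-- A closed subgroup containing all commutators of a non-power `f` with the endomorphisms that
are trivial on the torsion contains all endomorphisms that are trivial on the torsion. -/
theorem mem_of_commutators {f : CircleEnd} (hf : NotPower f) (B : Subgroup CircleEnd)
    (hB : IsClosed (B : Set CircleEnd))
    (h : ∀ θ : CircleEnd, rootsQ ≤ θ.ker → f.comp θ / θ.comp f ∈ B)
    {θ : CircleEnd} (hθ : rootsQ ≤ θ.ker) : θ ∈ B := by
  refine mem_of_annihilator B hB θ fun x hx => ?_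
  by_contra hθx
  have hxQ : x ∉ rootsQ := fun hxQ => hθx (hθ hxQ)
  have hcomm : ∀ η : CircleEnd, rootsQ ≤ η.ker → f (η x) = η (f x) := by
    intro η hη
    have := hx _ (h η hη)
    rw [MonoidHom.div_apply, div_eq_one] at this
    exact this
  -- Otherwise some character kills the torsion and `x` but not `f x`, contradicting `hcomm`.
  have hmem : f x ∈ rootsQ ⊔ Subgroup.zpowers x := by
    by_contra hmem
    obtain ⟨c, hc⟩ := exists_character_ne_one (Γ := Circle ⧸ (rootsQ ⊔ Subgroup.zpowers x))
      (z := (f x : Circle ⧸ (rootsQ ⊔ Subgroup.zpowers x)))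
      (fun h => hmem ((QuotientGroup.eq_one_iff _).1 h))
    have hker : ∀ y ∈ rootsQ ⊔ Subgroup.zpowers x,
        c.comp (QuotientGroup.mk' (rootsQ ⊔ Subgroup.zpowers x)) y = 1 := by
      intro y hy
      rw [MonoidHom.comp_apply, QuotientGroup.mk'_apply, (QuotientGroup.eq_one_iff y).2 hy,
        map_one]
    refine hc ?_
    have := hcomm (c.comp (QuotientGroup.mk' (rootsQ ⊔ Subgroup.zpowers x)))
      (fun y hy => hker y (Subgroup.mem_sup_left hy))
    rw [hker x (Subgroup.mem_sup_right (Subgroup.mem_zpowers x)), map_one] at this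
    exact this.symm
  obtain ⟨τ, hτ, y, hy, hxy⟩ := Subgroup.mem_sup.1 hmem
  obtain ⟨n, rfl⟩ := Subgroup.mem_zpowers_iff.1 hy
  -- Now `f x` is `x ^ n` up to torsion, so `f (η x) = (η x) ^ n`. Since `η x` can be any point, `f`
  -- would be the `n`-th power map.
  obtain ⟨t, ht⟩ := hf n
  obtain ⟨η, hη, rfl⟩ := exists_torsionFree_eq hxQ t
  refine ht ?_
  rw [hcomm η hη, ← hxy, map_mul, map_zpow, show η τ = 1 from hη hτ, one_mul]

end CircleEnd

/-! ### The filtration of `𝓗` by the kernels of the truncations -/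

namespace ScrH

lemma zeroTilde_of_pos {k : ℕ} (hk : k ≠ 0) : zeroTilde k = 1 := by
  obtain ⟨k, rfl⟩ := Nat.exists_eq_succ_of_ne_zero hk
  rfl

lemma apply_zero (φ : scrH) : φ.1 0 = MonoidHom.id Circle := φ.2.1

lemma mul_congr {a b c d : scrH} {k : ℕ} (h : ∀ i ≤ k, a.1 i = b.1 i)
    (h' : ∀ i ≤ k, c.1 i = d.1 i) : (a * c).1 k = (b * d).1 k := by
  rw [coe_mul, coe_mul, starProd, starProd]
  refine Finset.prod_congr rfl fun j hj => ?_
  have := Finset.mem_range.1 hj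
  rw [h _ (by omega), h' _ (by omega)]

lemma mul_succ (φ ψ : scrH) (k : ℕ) : (φ * ψ).1 (k + 1) =
    φ.1 (k + 1) * ψ.1 (k + 1) * ∏ i ∈ Finset.range k, (φ.1 (k - i)).comp (ψ.1 (i + 1)) := by
  rw [coe_mul, starProd, Finset.prod_range_succ', Finset.prod_range_succ]
  simp only [Nat.sub_self, Nat.sub_zero, apply_zero, MonoidHom.comp_id, MonoidHom.id_comp,
    Nat.add_sub_add_right]
  rw [mul_comm, ← mul_assoc, mul_right_comm]

/-- The kernel of the truncation `ρ_n`. -/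
noncomputable def trunc (n : ℕ) : Subgroup scrH where
  carrier := {φ | ∀ k ≤ n, φ.1 k = zeroTilde k}
  one_mem' := fun _ _ => rfl
  mul_mem' := by
    intro a b ha hb k hk
    rw [mul_congr (b := 1) (d := 1) (fun i hi => ha i (hi.trans hk))
      (fun i hi => hb i (hi.trans hk)), mul_one]
    rfl
  inv_mem' := by
    intro a ha k hk
    rw [← one_mul a⁻¹, mul_congr (b := a) (d := a⁻¹) (fun i hi => (ha i (hi.trans hk)).symm)
      (fun _ _ => rfl), mul_inv_cancel]
    rfl

lemma mem_trunc {n : ℕ} {φ : scrH} : φ ∈ trunc n ↔ ∀ k ≤ n, φ.1 k = zeroTilde k := Iff.rfl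

lemma mem_trunc_zero (φ : scrH) : φ ∈ trunc 0 := by
  intro k hk
  obtain rfl : k = 0 := by omega
  exact φ.2.1

lemma apply_eq_one {n k : ℕ} {φ : scrH} (h : φ ∈ trunc n) (h0 : k ≠ 0) (hk : k ≤ n) :
    φ.1 k = 1 := by
  rw [h k hk, zeroTilde_of_pos h0]

lemma mem_trunc_succ {n : ℕ} {φ : scrH} (h : φ ∈ trunc n) (h1 : φ.1 (n + 1) = 1) :
    φ ∈ trunc (n + 1) := by
  intro k hk
  rcases Nat.lt_or_ge n k with h' | h'
  · obtain rfl : k = n + 1 := by omega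
    exact h1
  · exact h k h'

/-- In each mixed term of the product, one of the two composed coordinates is still in the trivial
range. The first mixed term to survive appears at index `r + j + 2`. -/
lemma mul_apply_of_mem_trunc {φ ψ : scrH} {r j k : ℕ} (hφ : φ ∈ trunc r) (hψ : ψ ∈ trunc j)
    (h0 : k ≠ 0) (hk : k ≤ r + j + 1) : (φ * ψ).1 k = φ.1 k * ψ.1 k := by
  obtain ⟨k, rfl⟩ := Nat.exists_eq_succ_of_ne_zero h0
  rw [Nat.succ_eq_add_one, mul_succ, Finset.prod_eq_one, mul_one]
  intro i hi
  have := Finset.mem_range.1 hi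
  rcases Nat.lt_or_ge i j with h | h
  · rw [apply_eq_one hψ (by omega) (by omega), MonoidHom.comp_one]
  · rw [apply_eq_one hφ (by omega) (by omega), MonoidHom.one_comp]

lemma mul_apply_lead {φ ψ : scrH} {r j : ℕ} (hφ : φ ∈ trunc r) (hψ : ψ ∈ trunc j) :
    (φ * ψ).1 (r + j + 2) =
      φ.1 (r + j + 2) * ψ.1 (r + j + 2) * (φ.1 (r + 1)).comp (ψ.1 (j + 1)) := by
  rw [mul_succ, Finset.prod_eq_single j]
  · rw [show r + j + 1 - j = r + 1 by omega]
  · intro i hi hij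
    have := Finset.mem_range.1 hi
    rcases Nat.lt_or_ge i j with h | h
    · rw [apply_eq_one hψ (by omega) (by omega), MonoidHom.comp_one]
    · rw [apply_eq_one hφ (by omega) (by omega), MonoidHom.one_comp]
  · intro h
    exact absurd (Finset.mem_range.2 (by omega)) h

lemma mul_inv_mem_trunc {a b : scrH} {n : ℕ} (h : ∀ k ≤ n, a.1 k = b.1 k) :
    b * a⁻¹ ∈ trunc n := by
  intro k hk
  rw [mul_congr (b := a) (d := a⁻¹) (fun i hi => (h i (hi.trans hk)).symm) (fun _ _ => rfl),
    mul_inv_cancel]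
  rfl

lemma mul_inv_apply {a b : scrH} {n : ℕ} (h : ∀ k ≤ n, a.1 k = b.1 k) :
    (b * a⁻¹).1 (n + 1) = b.1 (n + 1) / a.1 (n + 1) := by
  have := mul_apply_of_mem_trunc (k := n + 1) (mul_inv_mem_trunc h) (mem_trunc_zero a)
    (by omega) (by omega)
  rw [inv_mul_cancel_right] at this
  rw [this, mul_div_cancel_right]

lemma commutator_agree {φ ψ : scrH} {r j : ℕ} (hφ : φ ∈ trunc r) (hψ : ψ ∈ trunc j) :
    ∀ k ≤ r + j + 1, (ψ * φ).1 k = (φ * ψ).1 k := by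
  intro k hk
  rcases Nat.eq_zero_or_pos k with rfl | h0
  · rw [apply_zero, apply_zero]
  · rw [mul_apply_of_mem_trunc hφ hψ h0.ne' hk,
      mul_apply_of_mem_trunc hψ hφ h0.ne' (by omega), mul_comm]

lemma commutator_mem_trunc {φ ψ : scrH} {r j : ℕ} (hφ : φ ∈ trunc r) (hψ : ψ ∈ trunc j) :
    φ * ψ * (ψ * φ)⁻¹ ∈ trunc (r + j + 1) :=
  mul_inv_mem_trunc (commutator_agree hφ hψ)

lemma commutator_lead {φ ψ : scrH} {r j : ℕ} (hφ : φ ∈ trunc r) (hψ : ψ ∈ trunc j) :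
    (φ * ψ * (ψ * φ)⁻¹).1 (r + j + 2) =
      (φ.1 (r + 1)).comp (ψ.1 (j + 1)) / (ψ.1 (j + 1)).comp (φ.1 (r + 1)) := by
  rw [mul_inv_apply (commutator_agree hφ hψ)]
  have h := mul_apply_lead hψ hφ
  rw [add_comm j r] at h
  rw [mul_apply_lead hφ hψ, h, mul_comm (ψ.1 _), mul_div_mul_left_eq_div]

lemma single_mem {n : ℕ} {θ : CircleEnd} (hθ : rootsQ ≤ θ.ker) :
    Function.update zeroTilde (n + 1) θ ∈ scrH := by
  have key : ∀ k, k ≠ 0 → ∀ x ∈ rootsQ, Function.update zeroTilde (n + 1) θ k x = 1 := by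
    intro k hk x hx
    rcases eq_or_ne k (n + 1) with rfl | h
    · rw [Function.update_self]
      exact hθ hx
    · rw [Function.update_of_ne h, zeroTilde_of_pos hk, MonoidHom.one_apply]
  refine ⟨by rw [Function.update_of_ne (by omega)]; rfl, fun k hk x hx => ?_⟩
  rw [key k (by omega) _ (pow_mem hx _), Finset.prod_eq_one]
  intro j hj
  obtain ⟨j, rfl⟩ : ∃ i, j = i + 1 := ⟨j - 1, by have := (Finset.mem_Icc.1 hj).1; omega⟩
  rw [Function.iterate_succ_apply, key 1 one_ne_zero _ (zpow_mem hx _)]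
  exact iterate_map_one _ _

/-- The element `(id, 1, …, 1, θ, 1, …)` of `𝓗`, for `θ` trivial on the torsion. -/
noncomputable def single (n : ℕ) (θ : CircleEnd) (hθ : rootsQ ≤ θ.ker) : scrH :=
  ⟨_, single_mem (n := n) hθ⟩

lemma single_mem_trunc (n : ℕ) (θ : CircleEnd) (hθ : rootsQ ≤ θ.ker) :
    single n θ hθ ∈ trunc n := by
  intro k hk
  exact Function.update_of_ne (by omega) _ _

lemma single_apply (n : ℕ) (θ : CircleEnd) (hθ : rootsQ ≤ θ.ker) :
    (single n θ hθ).1 (n + 1) = θ := Function.update_self _ _ _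

/-- On torsion the Stirling relation expresses `φ_k` through iterates of `φ_1`, and roots of unity
have roots of unity as `k!`-th roots. -/
lemma rootsQ_le_ker {φ : scrH} (h1 : φ.1 1 = 1) {k : ℕ} (hk : k ≠ 0) :
    rootsQ ≤ (φ.1 k).ker := by
  intro x hx
  obtain ⟨y, rfl⟩ := exists_root x (Nat.factorial_pos k)
  have hy : y ∈ rootsQ := by
    obtain ⟨m, hm, h⟩ := isOfFinOrder_iff_pow_eq_one.1 hx
    rw [← pow_mul] at h
    exact isOfFinOrder_iff_pow_eq_one.2 ⟨_, Nat.mul_pos (Nat.factorial_pos k) hm, h⟩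
  rw [MonoidHom.mem_ker, φ.2.2 k (by omega) y hy, Finset.prod_eq_one]
  intro j hj
  obtain ⟨j, rfl⟩ : ∃ i, j = i + 1 := ⟨j - 1, by have := (Finset.mem_Icc.1 hj).1; omega⟩
  rw [Function.iterate_succ_apply, h1, MonoidHom.one_apply]
  exact iterate_map_one _ _

/-- The leading coefficient on the kernel of `ρ_n`. -/
noncomputable def leadHom (n : ℕ) : trunc n →* CircleEnd :=
  MonoidHom.mk' (fun φ => φ.1.1 (n + 1)) fun φ ψ =>
    mul_apply_of_mem_trunc φ.2 ψ.2 (by omega) (by omega)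

/-- The leading coefficients of level `n + 1` of the elements of `E`. -/
noncomputable def lead (E : Subgroup scrH) (n : ℕ) : Subgroup CircleEnd :=
  (E.subgroupOf (trunc n)).map (leadHom n)

lemma mem_lead {E : Subgroup scrH} {n : ℕ} {θ : CircleEnd} :
    θ ∈ lead E n ↔ ∃ κ ∈ E, κ ∈ trunc n ∧ κ.1 (n + 1) = θ := by
  constructor
  · rintro ⟨κ, hκ, rfl⟩
    exact ⟨κ.1, hκ, κ.2, rfl⟩
  · rintro ⟨κ, hκ, hn, rfl⟩
    exact ⟨⟨κ, hn⟩, hκ, rfl⟩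

/-! ### Topology of `𝓗` and leading coefficients of closed subgroups -/

lemma continuous_apply (k : ℕ) : Continuous fun φ : scrH => φ.1 k :=
  (_root_.continuous_apply k).comp continuous_subtype_val

/-- Here `φ` is evaluated only at the fixed points `ψ_j x`. The argument does not apply to left
translations, where a possibly discontinuous endomorphism meets a varying point. -/
lemma continuous_mul_const (ψ : scrH) : Continuous fun φ : scrH => φ * ψ := by
  refine Continuous.subtype_mk (continuous_pi fun k => CircleEnd.continuous_iff.2 fun x => ?_) _
  change Continuous fun φ : scrH => starProd φ.1 ψ.1 k x
  simp only [starProd_apply]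
  exact continuous_finsetProd _ fun j _ => (CircleEnd.continuous_apply _).comp (continuous_apply _)

lemma continuous_shiftT : Continuous shiftT := by
  refine Continuous.subtype_mk (continuous_pi fun k => ?_) _
  cases k with
  | zero => exact continuous_apply 0
  | succ k => exact (continuous_apply k).mul (continuous_apply (k + 1))

lemma finite_roots {N : ℕ} (hN : 0 < N) : {x : Circle | x ^ N = 1}.Finite := by
  have h : {z : ℂ | z ^ N = 1}.Finite := by
    refine (Polynomial.nthRoots N (1 : ℂ)).toFinset.finite_toSet.subset fun z hz => ?_
    rw [Finset.mem_coe, Multiset.mem_toFinset, Polynomial.mem_nthRoots hN]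
    exact hz
  refine Set.Finite.of_finite_image (f := ((↑) : Circle → ℂ)) (h.subset ?_)
    Subtype.val_injective.injOn
  rintro _ ⟨x, hx, rfl⟩
  have hx : x ^ N = 1 := hx
  change (x : ℂ) ^ N = 1
  rw [← Circle.coe_pow, hx, Circle.coe_one]

/-- By `mem_iff`, membership is a family of conditions on the `N`-torsion and coordinates up to `K`.
Each allows finitely many patterns of values, since the `N`-torsion is finite. -/
lemma isClosed_scrH : IsClosed scrH := by
  let R (K N : ℕ) : Set (Fin (K + 1) → {x : Circle | x ^ N = 1} → Circle) :=
    Set.range fun (n : ℤ) k x => (x : Circle) ^ Ring.choose n (k : ℕ)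
  have hR : ∀ K N, 0 < N → IsClosed (R K N) := by
    intro K N hN
    have : Finite {x : Circle | x ^ N = 1} := finite_roots hN
    refine Set.Finite.isClosed (Set.Finite.subset (Set.Finite.pi' fun _ => Set.Finite.pi'
      fun _ => finite_roots hN) ?_)
    rintro _ ⟨n, rfl⟩ k x
    exact pow_zpow_eq_one x.2 _
  have h : scrH = {φ : ℕ → CircleEnd | φ 0 = MonoidHom.id Circle} ∩
      ⋂ K, ⋂ N, ⋂ (_ : 0 < N),
        (fun (φ : ℕ → CircleEnd) (k : Fin (K + 1)) (x : {x : Circle | x ^ N = 1}) =>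
          φ k (x : Circle)) ⁻¹' R K N := by
    ext φ
    rw [mem_iff]
    simp only [Set.mem_inter_iff, Set.mem_iInter]
    refine and_congr Iff.rfl (forall_congr' fun K => forall_congr' fun N => forall_congr' fun hN =>
      exists_congr fun n => ?_)
    constructor
    · intro h
      funext k x
      exact (h k (by omega) x x.2).symm
    · intro h k hk x hx
      exact (congrFun (congrFun h ⟨k, by omega⟩) ⟨x, hx⟩).symm
  rw [h]
  refine (isClosed_eq (_root_.continuous_apply 0) continuous_const).inter
    (isClosed_iInter fun K => isClosed_iInter fun N => isClosed_iInter fun hN =>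
      (hR K N hN).preimage ?_)
  exact continuous_pi fun k => continuous_pi fun x =>
    (CircleEnd.continuous_apply _).comp (_root_.continuous_apply _)

instance : CompactSpace scrH := isCompact_iff_compactSpace.1 isClosed_scrH.isCompact

instance : T2Space scrH := inferInstanceAs (T2Space {φ // φ ∈ scrH})

lemma isClosed_trunc (n : ℕ) : IsClosed (trunc n : Set scrH) := by
  have : (trunc n : Set scrH) = ⋂ k, ⋂ (_ : k ≤ n), {φ : scrH | φ.1 k = zeroTilde k} := by
    ext φ
    simp [mem_trunc]
  rw [this]
  exact isClosed_iInter fun k => isClosed_iInter fun _ =>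
    isClosed_eq (continuous_apply k) continuous_const

lemma isClosed_lead {E : Subgroup scrH} (hE : IsClosed (E : Set scrH)) (n : ℕ) :
    IsClosed (lead E n : Set CircleEnd) := by
  have : (lead E n : Set CircleEnd) =
      (fun φ : scrH => φ.1 (n + 1)) '' ((E : Set scrH) ∩ trunc n) := by
    ext θ
    rw [SetLike.mem_coe, mem_lead]
    simp [and_assoc]
  rw [this]
  exact ((hE.inter (isClosed_trunc n)).isCompact.image (continuous_apply _)).isClosed

/-- A closed subgroup with all leading coefficients beyond level `r` contains `ker ρ_r`. -/
theorem trunc_le_of_lead {E : Subgroup scrH} (hE : IsClosed (E : Set scrH)) {r : ℕ}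
    (h : ∀ n, r ≤ n → ∀ φ ∈ trunc n, φ.1 (n + 1) ∈ lead E n) : trunc r ≤ E := by
  intro φ hφ
  -- Successive approximation: each stage corrects one more coordinate by an element of `E` with the
  -- prescribed leading coefficient, and closedness of `E` captures the limit `φ`.
  have key : ∀ i, ∃ κ ∈ E, ∀ k ≤ r + i, κ.1 k = φ.1 k := by
    intro i
    induction i with
    | zero => exact ⟨1, one_mem E, fun k hk => (hφ k hk).symm⟩
    | succ i ih =>
      obtain ⟨κ, hκ, hagree⟩ := ih
      have h1 := mul_inv_mem_trunc hagree
      obtain ⟨κ', hκ', ht, hlead⟩ := mem_lead.1 (h _ (by omega) _ h1)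
      refine ⟨κ' * κ, mul_mem hκ' hκ, fun k hk => ?_⟩
      rcases Nat.eq_zero_or_pos k with rfl | h0
      · rw [apply_zero, apply_zero]
      rw [mul_apply_of_mem_trunc ht (mem_trunc_zero κ) h0.ne' (by omega)]
      rcases Nat.lt_or_ge (r + i) k with h' | h'
      · obtain rfl : k = r + i + 1 := by omega
        rw [hlead, mul_inv_apply hagree, div_mul_cancel]
      · rw [apply_eq_one ht h0.ne' h', one_mul, hagree k h']
  choose κ hκ hagree using key
  refine hE.mem_of_tendsto (b := atTop) (f := κ) ?_ (Eventually.of_forall hκ)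
  rw [tendsto_subtype_rng, tendsto_pi_nhds]
  intro k
  refine tendsto_const_nhds.congr' ?_
  filter_upwards [eventually_ge_atTop k] with i hi
  exact (hagree i k (by omega)).symm

/-- The commutator argument: the leading coefficients of `E` at level `r + j + 2` are full. -/
theorem mem_lead_of_commutators {E : Subgroup scrH} (hE : IsClosed (E : Set scrH)) {φ : scrH}
    {r j : ℕ} (hφ : φ ∈ trunc r) (hf : CircleEnd.NotPower (φ.1 (r + 1)))
    (h : ∀ θ : CircleEnd, rootsQ ≤ θ.ker → ∃ ψ ∈ trunc j, ψ.1 (j + 1) = θ ∧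
      φ * ψ * (ψ * φ)⁻¹ ∈ E)
    {θ : CircleEnd} (hθ : rootsQ ≤ θ.ker) : θ ∈ lead E (r + j + 1) := by
  refine CircleEnd.mem_of_commutators hf _ (isClosed_lead hE _) (fun η hη => ?_) hθ
  obtain ⟨ψ, hψ, rfl, hE⟩ := h η hη
  exact mem_lead.2 ⟨_, hE, commutator_mem_trunc hφ hψ, commutator_lead hφ hψ⟩

lemma rootsQ_le_ker_of_mem_trunc {n : ℕ} (hn : n ≠ 0) {φ : scrH} (hφ : φ ∈ trunc n) :
    rootsQ ≤ (φ.1 (n + 1)).ker :=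
  rootsQ_le_ker (apply_eq_one hφ one_ne_zero (by omega)) (by omega)

/-- Normality puts the commutators of an element of `K` with every `single j θ` into `K`, which
fills all leading coefficients from level `r + 2` on. This needs a non-power leading coefficient. -/
theorem trunc_le_of_normal {K : Subgroup scrH} [K.Normal] (hK : IsClosed (K : Set scrH))
    {φ : scrH} {r : ℕ} (hφK : φ ∈ K) (hφ : φ ∈ trunc r) (h1 : φ.1 (r + 1) ≠ 1) :
    trunc (r + 1) ≤ K := by
  obtain ⟨κ, hκK, hκ, hf⟩ : ∃ κ ∈ K, κ ∈ trunc r ∧ CircleEnd.NotPower (κ.1 (r + 1)) := by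
    by_cases hf : CircleEnd.NotPower (φ.1 (r + 1))
    · exact ⟨φ, hφK, hφ, hf⟩
    rcases eq_or_ne r 0 with rfl | hr
    -- Only at the first level can the coefficient be a nontrivial power map. Its annihilator is
    -- then torsion, so duality supplies every coefficient trivial on torsion; a nontrivial one of
    -- these is not a power.
    · have hle : ∀ θ : CircleEnd, rootsQ ≤ θ.ker → θ ∈ lead K 0 := by
        intro θ hθ
        refine CircleEnd.mem_of_annihilator _ (isClosed_lead hK 0) θ fun x hx => hθ ?_
        have hx := hx _ (mem_lead.2 ⟨φ, hφK, hφ, rfl⟩)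
        simp only [CircleEnd.NotPower, not_forall, not_exists, not_not] at hf
        obtain ⟨n, hn⟩ := hf
        refine isOfFinOrder_iff_zpow_eq_one.2 ⟨n, ?_, (hn x).symm.trans hx⟩
        rintro rfl
        exact h1 (MonoidHom.ext fun x => by rw [hn x, zpow_zero, MonoidHom.one_apply])
      obtain ⟨x, hx⟩ := CircleEnd.exists_notMem_rootsQ
      obtain ⟨θ, hθ, hθx⟩ := CircleEnd.exists_torsionFree_eq hx (-1)
      obtain ⟨κ, hκK, hκ, rfl⟩ := mem_lead.1 (hle θ hθ)
      refine ⟨κ, hκK, hκ, CircleEnd.notPower_of_rootsQ_le hθ fun h => ?_⟩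
      rw [h, MonoidHom.one_apply] at hθx
      have := congrArg (fun z : Circle => (z : ℂ).re) hθx
      norm_num at this
    · exact absurd (CircleEnd.notPower_of_rootsQ_le (rootsQ_le_ker_of_mem_trunc hr hφ) h1) hf
  refine trunc_le_of_lead hK fun n hn ψ hψ => ?_
  obtain ⟨j, rfl⟩ := Nat.exists_eq_add_of_le hn
  rw [show r + 1 + j = r + j + 1 by omega] at hψ ⊢
  refine mem_lead_of_commutators hK hκ hf (fun θ hθ =>
    ⟨single j θ hθ, single_mem_trunc j θ hθ, single_apply j θ hθ, ?_⟩)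
    (rootsQ_le_ker_of_mem_trunc (by omega) hψ)
  -- The commutator is regrouped as `κ` times a conjugate of `κ⁻¹`.
  rw [mul_inv_rev, mul_assoc, ← mul_assoc _ κ⁻¹ _]
  exact mul_mem hκK (Subgroup.Normal.conj_mem inferInstance _ (inv_mem hκK) _)

/-! ### Density of the orbit of `0̃` -/

/-- Since `T 0̃ = (id, id, 1, 1, …)`, only two terms of each product survive. -/
lemma shiftT_one_mul (φ : scrH) : shiftT 1 * φ = shiftT φ := by
  refine Subtype.ext (funext fun k => ?_)
  cases k with
  | zero => exact (apply_zero _).trans (apply_zero _).symm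
  | succ k =>
    have h : ∀ i, (shiftT 1).1 (i + 1) = zeroTilde i * zeroTilde (i + 1) := fun _ => rfl
    rw [mul_succ, h]
    change _ = φ.1 k * φ.1 (k + 1)
    cases k with
    | zero =>
      rw [apply_zero]
      simp [zeroTilde]
    | succ k =>
      rw [Finset.prod_range_succ, Finset.prod_eq_one]
      · rw [Nat.add_sub_cancel_left, h]
        simp [zeroTilde, mul_comm]
      · intro i hi
        have := Finset.mem_range.1 hi
        obtain ⟨l, hl⟩ : ∃ l, k + 1 - i = l + 2 := ⟨k - 1 - i, by omega⟩
        rw [hl, h]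
        simp [zeroTilde]

lemma shiftT_one_apply : (shiftT 1).1 1 = MonoidHom.id Circle := by
  change zeroTilde 0 * zeroTilde 1 = _
  simp [zeroTilde]

/-- `T` as a homeomorphism, left multiplication by `T 0̃`. -/
noncomputable def shiftHomeo : scrH ≃ₜ scrH :=
  Continuous.homeoOfEquivCompactToT2 (f := Equiv.mulLeft (shiftT 1)) (by
    simpa only [Equiv.coe_mulLeft, shiftT_one_mul] using continuous_shiftT)

lemma continuous_const_mul_zpow (n : ℤ) : Continuous fun φ : scrH => shiftT 1 ^ n * φ := by
  have h : ∀ n : ℤ, (fun φ : scrH => shiftT 1 ^ n * φ) = ⇑(shiftHomeo ^ n) := by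
    intro n
    induction n using Int.induction_on with
    | zero => funext φ; simp
    | succ n ih =>
      funext φ
      rw [zpow_add_one, zpow_add_one, mul_assoc]
      exact congrFun ih (shiftT 1 * φ)
    | pred n ih =>
      funext φ
      rw [zpow_sub_one, zpow_sub_one, mul_assoc]
      exact congrFun ih ((shiftT 1)⁻¹ * φ)
  rw [h n]
  exact (shiftHomeo ^ n).continuous

/-- The closure of the orbit of `0̃`, a subgroup of `𝓗`. -/
noncomputable def orbitClosure : Subgroup scrH :=
  have hmul : ∀ a ∈ closure (Subgroup.zpowers (shiftT 1) : Set scrH),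
      ∀ b ∈ closure (Subgroup.zpowers (shiftT 1) : Set scrH),
        a * b ∈ closure (Subgroup.zpowers (shiftT 1) : Set scrH) := by
    intro a ha b hb
    refine closure_minimal (t := (· * b) ⁻¹' _) ?_
      (isClosed_closure.preimage (continuous_mul_const b)) ha
    rintro _ ⟨n, rfl⟩
    refine closure_minimal (t := (shiftT 1 ^ n * ·) ⁻¹' _) ?_
      (isClosed_closure.preimage (continuous_const_mul_zpow n)) hb
    intro c hc
    exact subset_closure (mul_mem ⟨n, rfl⟩ hc)
  { carrier := closure (Subgroup.zpowers (shiftT 1) : Set scrH)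
    one_mem' := subset_closure (one_mem _)
    mul_mem' := fun ha hb => hmul _ ha _ hb
    inv_mem' := by
      intro a ha
      -- Inversion need not be continuous, so Ellis' idempotent theorem is applied to the compact
      -- semigroup of multiples `b * a`. In a group the idempotent is `1`, so `a⁻¹ = b` lies in the
      -- closure.
      obtain ⟨e, ⟨b, hb, rfl⟩, he⟩ := exists_idempotent_in_compact_subsemigroup
        continuous_mul_const ((· * a) '' closure (Subgroup.zpowers (shiftT 1) : Set scrH))
        ⟨_, 1, subset_closure (one_mem _), rfl⟩
        (isClosed_closure.isCompact.image (continuous_mul_const a)) (by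
          rintro _ ⟨b, hb, rfl⟩ _ ⟨c, hc, rfl⟩
          exact ⟨b * a * c, hmul _ (hmul _ hb _ ha) _ hc, by simp only [mul_assoc]⟩)
      have h1 : b * a = 1 := mul_eq_left.1 he
      rwa [← eq_inv_of_mul_eq_one_left h1] }

lemma orbitClosure_eq_top : orbitClosure = ⊤ := by
  have hcl : IsClosed (orbitClosure : Set scrH) := isClosed_closure
  -- `T 0̃` contributes the identity map as a coefficient, and its annihilator is trivial.
  have h0 : lead orbitClosure 0 = ⊤ := by
    refine eq_top_iff.2 fun α _ => CircleEnd.mem_of_annihilator _ (isClosed_lead hcl 0) α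
      fun x hx => ?_
    have := hx (MonoidHom.id Circle) (mem_lead.2 ⟨shiftT 1,
      subset_closure (Subgroup.mem_zpowers _), mem_trunc_zero _, shiftT_one_apply⟩)
    rw [show x = 1 from this, map_one]
  have hlead : ∀ n, ∀ θ : CircleEnd, rootsQ ≤ θ.ker → θ ∈ lead orbitClosure n := by
    obtain ⟨x, hx⟩ := CircleEnd.exists_notMem_rootsQ
    obtain ⟨η, hη, hηx⟩ := CircleEnd.exists_torsionFree_eq hx (-1)
    obtain ⟨κ, hκE, hκ, rfl⟩ := mem_lead.1 (h0 ▸ Subgroup.mem_top η)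
    have hf : CircleEnd.NotPower (κ.1 1) := CircleEnd.notPower_of_rootsQ_le hη fun h => by
      rw [h, MonoidHom.one_apply] at hηx
      have := congrArg (fun z : Circle => (z : ℂ).re) hηx
      norm_num at this
    intro n
    induction n with
    | zero => intro θ _; rw [h0]; trivial
    | succ n ih =>
      intro θ hθ
      -- Commutators of `κ` with elements realising the coefficients of one level fill the next; all
      -- of them stay in the subgroup `orbitClosure`.
      have := mem_lead_of_commutators hcl (j := n) hκ hf (fun θ hθ => by
        obtain ⟨ψ, hψE, hψ, h⟩ := mem_lead.1 (ih θ hθ)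
        exact ⟨ψ, hψ, h, mul_mem (mul_mem hκE hψE) (inv_mem (mul_mem hψE hκE))⟩) hθ
      rwa [zero_add] at this
  refine eq_top_iff.2 fun φ _ => trunc_le_of_lead hcl (r := 0) (fun n _ ψ hψ => ?_)
    (mem_trunc_zero φ)
  rcases eq_or_ne n 0 with rfl | hn
  · rw [h0]; trivial
  · exact hlead n _ (rootsQ_le_ker_of_mem_trunc hn hψ)

theorem dense_orbit : Dense (Set.range fun n : ℤ => (shiftT 1 ^ n : scrH)) := by
  intro φ
  have : φ ∈ orbitClosure := orbitClosure_eq_top ▸ Subgroup.mem_top φ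
  exact this

/-! ### The kernel of the action on `𝓗 / 𝓖` -/

lemma rho_eq_iff {m : ℕ} {φ ψ : scrH} : rho m φ = rho m ψ ↔ ∀ k ≤ m, φ.1 k = ψ.1 k := by
  rw [Subtype.ext_iff, funext_iff]
  exact ⟨fun h k hk => h ⟨k, by omega⟩, fun h k => h k (by omega)⟩

lemma subset_preimage_rho (G : Subgroup scrH) (m : ℕ) :
    (G : Set scrH) ⊆ rho m ⁻¹' (rho m '' (G : Set scrH)) := Set.subset_preimage_image _ _

lemma preimage_rho_eq_iff {G : Subgroup scrH} {m : ℕ} :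
    rho m ⁻¹' (rho m '' (G : Set scrH)) = G ↔ trunc m ≤ G := by
  constructor
  · intro h φ hφ
    rw [← SetLike.mem_coe, ← h]
    exact ⟨1, one_mem G, rho_eq_iff.2 fun k hk => (hφ k hk).symm⟩
  · intro h
    refine Set.Subset.antisymm ?_ (subset_preimage_rho G m)
    rintro φ ⟨g, hg, hgφ⟩
    have := h (mul_inv_mem_trunc (rho_eq_iff.1 hgφ))
    exact (Subgroup.mul_mem_cancel_right G (inv_mem hg)).1 this

lemma exists_lead {φ : scrH} {n : ℕ} (h : φ ∉ trunc n) :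
    ∃ r < n, φ ∈ trunc r ∧ φ.1 (r + 1) ≠ 1 := by
  induction n with
  | zero => exact absurd (mem_trunc_zero φ) h
  | succ n ih =>
    by_cases hn : φ ∈ trunc n
    · exact ⟨n, n.lt_succ_self, hn, fun h1 => h (mem_trunc_succ hn h1)⟩
    · obtain ⟨r, hr, h⟩ := ih hn
      exact ⟨r, by omega, h⟩

lemma actionKernel_le (G : Subgroup scrH) : actionKernel G ≤ G := by
  intro φ hφ
  have := mem_actionKernel.1 hφ 1
  rw [mul_one, QuotientGroup.eq, mul_one] at this
  exact inv_mem_iff.1 this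

lemma isClosed_actionKernel (G : Subgroup scrH) [T2Space (scrH ⧸ G)] :
    IsClosed (actionKernel G : Set scrH) := by
  have : (actionKernel G : Set scrH) =
      ⋂ ψ : scrH, {φ | ((φ * ψ : scrH) : scrH ⧸ G) = (ψ : scrH ⧸ G)} := by
    ext φ
    rw [SetLike.mem_coe, mem_actionKernel]
    simp
  rw [this]
  exact isClosed_iInter fun ψ => isClosed_eq
    (continuous_quotient_mk'.comp (continuous_mul_const ψ)) continuous_const

lemma exists_trunc_le {G : Subgroup scrH} [T2Space (scrH ⧸ G)] {φ : scrH} {n : ℕ}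
    (hφ : φ ∈ actionKernel G) (hn : φ ∉ trunc n) : ∃ r < n, trunc (r + 1) ≤ G := by
  obtain ⟨r, hr, h, h1⟩ := exists_lead hn
  exact ⟨r, hr, (trunc_le_of_normal (isClosed_actionKernel G) hφ h h1).trans (actionKernel_le G)⟩

theorem actionKernel_eq_of_isLeast {G : Subgroup scrH} [T2Space (scrH ⧸ G)] {m : ℕ}
    (hm : IsLeast {m : ℕ | 1 ≤ m ∧ rho m ⁻¹' (rho m '' (G : Set scrH)) = G} m) :
    (actionKernel G : Set scrH) = {φ | φ ∈ G ∧ ∀ k < m, φ.1 k = zeroTilde k} := by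
  obtain ⟨⟨h1, hG⟩, hmin⟩ := hm
  obtain ⟨n, rfl⟩ := Nat.exists_eq_add_of_le' h1
  rw [preimage_rho_eq_iff] at hG
  ext φ
  constructor
  · intro hφ
    refine ⟨actionKernel_le G hφ, fun k hk => ?_⟩
    suffices φ ∈ trunc n from this k (by omega)
    by_contra hn
    obtain ⟨r, hr, hle⟩ := exists_trunc_le hφ hn
    have := hmin ⟨Nat.le_add_left 1 r, preimage_rho_eq_iff.2 hle⟩
    omega
  · rintro ⟨hφG, hφ⟩
    have hφ : φ ∈ trunc n := fun k hk => hφ k (by omega)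
    rw [SetLike.mem_coe, mem_actionKernel]
    intro ψ
    -- `ψ⁻¹ * φ⁻¹ * ψ` is `φ⁻¹ ∈ G` times a commutator with an element of `trunc n`. That commutator
    -- lies in `trunc (n + 1) ≤ G`.
    have h := commutator_mem_trunc (inv_mem (mem_trunc_zero ψ)) (inv_mem hφ)
    rw [zero_add] at h
    rw [QuotientGroup.eq]
    have h2 : (φ * ψ)⁻¹ * ψ = ψ⁻¹ * φ⁻¹ * (φ⁻¹ * ψ⁻¹)⁻¹ * φ⁻¹ := by group
    rw [h2]
    exact mul_mem (hG h) (inv_mem hφG)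

theorem actionKernel_eq_one {G : Subgroup scrH} [T2Space (scrH ⧸ G)]
    (h : ∀ m : ℕ, 1 ≤ m → (G : Set scrH) ⊂ rho m ⁻¹' (rho m '' (G : Set scrH))) :
    (actionKernel G : Set scrH) = {φ | φ.1 = zeroTilde} := by
  ext φ
  constructor
  · intro hφ
    refine funext fun k => ?_
    suffices φ ∈ trunc k from this k le_rfl
    by_contra hk
    obtain ⟨r, -, hle⟩ := exists_trunc_le hφ hk
    exact (h (r + 1) (Nat.le_add_left 1 r)).ne (preimage_rho_eq_iff.2 hle).symm
  · intro hφ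
    obtain rfl : φ = 1 := Subtype.ext hφ
    exact one_mem _

/-! ### Factors of `(𝓗, T)` and their Ellis groups -/

section Factor

variable {X : Type u} [TopologicalSpace X] {s : X ≃ₜ X} {p : scrH → X}

lemma factor_zpow (hs : ∀ φ, p (shiftT φ) = s (p φ)) (n : ℤ) (φ : scrH) :
    p (shiftT 1 ^ n * φ) = (s ^ n) (p φ) := by
  induction n using Int.induction_on generalizing φ with
  | zero => simp
  | succ n ih =>
    rw [zpow_add_one, zpow_add_one, mul_assoc, ih, shiftT_one_mul, hs]
    rfl
  | pred n ih =>
    rw [zpow_sub_one, zpow_sub_one, mul_assoc, ih]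
    have h := hs ((shiftT 1)⁻¹ * φ)
    rw [← shiftT_one_mul, mul_inv_cancel_left] at h
    rw [h]
    exact congrArg (s ^ (-(n : ℤ))) (s.symm_apply_apply _).symm

/-- Equivariance gives this for `φ` a power of `T 0̃`; density and continuity of right translations
give it for all `φ`. It makes the action of `𝓗` descend to the factor. -/
lemma factor_mul_congr [T2Space X] (hp : Continuous p) (hs : ∀ φ, p (shiftT φ) = s (p φ))
    {ψ ψ' : scrH} (h : p ψ = p ψ') (φ : scrH) : p (φ * ψ) = p (φ * ψ') := by
  have := dense_orbit.induction (P := fun φ => p (φ * ψ) = p (φ * ψ')) (by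
    rintro _ ⟨n, rfl⟩
    rw [factor_zpow hs, factor_zpow hs, h])
    (isClosed_eq (hp.comp (continuous_mul_const ψ)) (hp.comp (continuous_mul_const ψ')))
  exact this φ

/-- The fibre over `p 0̃` of a factor map `p`. -/
noncomputable def fibre [T2Space X] (hp : Continuous p) (hs : ∀ φ, p (shiftT φ) = s (p φ)) :
    Subgroup scrH where
  carrier := {φ | p φ = p 1}
  one_mem' := rfl
  mul_mem' := by
    intro a b ha hb
    have h := factor_mul_congr hp hs hb a
    rw [mul_one] at h
    exact h.trans ha
  inv_mem' := by
    intro a ha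
    have h := factor_mul_congr hp hs ha a⁻¹
    rw [mul_one, inv_mul_cancel] at h
    exact h.symm

/-- The action of `𝓗` on a factor. -/
noncomputable def factorAct (hsurj : Function.Surjective p) (φ : scrH) (x : X) : X :=
  p (φ * Function.surjInv hsurj x)

lemma continuous_factorAct (hp : Continuous p) (hsurj : Function.Surjective p) :
    Continuous (factorAct hsurj) :=
  continuous_pi fun _ => hp.comp (continuous_mul_const _)

variable [T2Space X]

lemma factor_eq_iff (hp : Continuous p) (hs : ∀ φ, p (shiftT φ) = s (p φ)) {φ ψ : scrH} :
    p φ = p ψ ↔ (φ : scrH ⧸ fibre hp hs) = ψ := by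
  rw [QuotientGroup.eq]
  change _ ↔ p (φ⁻¹ * ψ) = p 1
  constructor
  · intro h
    rw [← factor_mul_congr hp hs h, inv_mul_cancel]
  · intro h
    have := factor_mul_congr hp hs h φ
    rw [mul_one, mul_inv_cancel_left] at this
    exact this.symm

lemma t2Space_quotient_fibre (hp : Continuous p) (hs : ∀ φ, p (shiftT φ) = s (p φ)) :
    T2Space (scrH ⧸ fibre hp hs) := by
  refine T2Space.of_injective_continuous
    (f := Quotient.lift p fun a b hab => (factor_eq_iff hp hs).2 (Quotient.sound hab)) ?_
    (hp.quotient_lift _)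
  intro a b
  induction a using QuotientGroup.induction_on
  induction b using QuotientGroup.induction_on
  exact (factor_eq_iff hp hs).1

lemma factorAct_apply (hp : Continuous p) (hs : ∀ φ, p (shiftT φ) = s (p φ))
    (hsurj : Function.Surjective p) (φ ψ : scrH) : factorAct hsurj φ (p ψ) = p (φ * ψ) :=
  factor_mul_congr hp hs (Function.surjInv_eq hsurj _) φ

lemma factorAct_mul (hp : Continuous p) (hs : ∀ φ, p (shiftT φ) = s (p φ))
    (hsurj : Function.Surjective p) (φ ψ : scrH) :
    factorAct hsurj (φ * ψ) = factorAct hsurj φ ∘ factorAct hsurj ψ := by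
  funext x
  obtain ⟨χ, rfl⟩ := hsurj x
  simp only [Function.comp_apply, factorAct_apply hp hs, mul_assoc]

lemma factorAct_eq_iff (hp : Continuous p) (hs : ∀ φ, p (shiftT φ) = s (p φ))
    (hsurj : Function.Surjective p) (φ ψ : scrH) :
    factorAct hsurj φ = factorAct hsurj ψ ↔
      (φ : scrH ⧸ actionKernel (fibre hp hs)) = ψ := by
  rw [QuotientGroup.eq, mem_actionKernel, funext_iff, hsurj.forall]
  refine forall_congr' fun χ => ?_
  rw [factorAct_apply hp hs, factorAct_apply hp hs, ← factor_eq_iff]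
  constructor
  · intro h
    rw [mul_assoc, ← factor_mul_congr hp hs h φ⁻¹, inv_mul_cancel_left]
  · intro h
    rw [← factor_mul_congr hp hs h φ, mul_assoc, mul_inv_cancel_left]

/-- The dense powers of `T 0̃` act as the powers of `s`, and the continuous image of the compact
space `𝓗` is closed. -/
lemma range_factorAct (hp : Continuous p) (hs : ∀ φ, p (shiftT φ) = s (p φ))
    (hsurj : Function.Surjective p) :
    Set.range (factorAct hsurj) = envelopingSemigroup s := by
  have h : ∀ n : ℤ, factorAct hsurj (shiftT 1 ^ n) = ⇑(s ^ n) := by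
    intro n
    funext x
    obtain ⟨χ, rfl⟩ := hsurj x
    rw [factorAct_apply hp hs, factor_zpow hs]
  have h2 : (Set.range fun n : ℤ => ⇑(s ^ n)) =
      factorAct hsurj '' Set.range fun n : ℤ => (shiftT 1 ^ n : scrH) := by
    rw [← Set.range_comp]
    exact congrArg Set.range (funext fun n => (h n).symm)
  have hc := continuous_factorAct hp hsurj
  rw [envelopingSemigroup, h2]
  refine Set.Subset.antisymm ?_
    (closure_minimal (Set.image_subset_range _ _) (isCompact_range hc).isClosed)
  rw [← Set.image_univ, ← dense_orbit.closure_eq]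
  exact image_closure_subset_closure_image hc

theorem exists_homeomorph_envelopingSemigroup (hp : Continuous p)
    (hs : ∀ φ, p (shiftT φ) = s (p φ)) (hsurj : Function.Surjective p) :
    ∃ e : (scrH ⧸ actionKernel (fibre hp hs)) ≃ₜ envelopingSemigroup s,
      (∀ a b, (e (a * b)).1 = (e a).1 ∘ (e b).1) ∧
      ∀ φ ψ : scrH, (e (φ : scrH ⧸ actionKernel (fibre hp hs))).1 (p ψ) = p (φ * ψ) := by
  let f : scrH ⧸ actionKernel (fibre hp hs) → envelopingSemigroup s :=
    Quotient.lift (fun φ => ⟨factorAct hsurj φ, range_factorAct hp hs hsurj ▸ ⟨φ, rfl⟩⟩)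
      fun a b hab => Subtype.ext ((factorAct_eq_iff hp hs hsurj a b).2 (Quotient.sound hab))
  have hf : Continuous f :=
    ((continuous_factorAct hp hsurj).subtype_mk _).quotient_lift _
  have hbij : Function.Bijective f := by
    constructor
    · intro a b
      induction a using QuotientGroup.induction_on
      induction b using QuotientGroup.induction_on
      exact fun h => (factorAct_eq_iff hp hs hsurj _ _).1 (congrArg Subtype.val h)
    · rintro ⟨g, hg⟩
      obtain ⟨φ, hφ⟩ : g ∈ Set.range (factorAct hsurj) := range_factorAct hp hs hsurj ▸ hg
      exact ⟨(φ : scrH ⧸ actionKernel (fibre hp hs)), Subtype.ext hφ⟩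
  refine ⟨hf.homeoOfEquivCompactToT2 (f := Equiv.ofBijective f hbij), fun a b => ?_,
    fun φ ψ => factorAct_apply hp hs hsurj φ ψ⟩
  induction a using QuotientGroup.induction_on
  induction b using QuotientGroup.induction_on
  exact factorAct_mul hp hs hsurj _ _

end Factor

theorem exists_homeomorph_quotient (G : Subgroup scrH) :
    ∃ s : (scrH ⧸ G) ≃ₜ (scrH ⧸ G), ∀ φ : scrH, (shiftT φ : scrH ⧸ G) = s (φ : scrH ⧸ G) := by
  refine ⟨{ toEquiv := MulAction.toPerm (shiftT 1)
            continuous_toFun := ?_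
            continuous_invFun := ?_ }, fun φ => ?_⟩
  · exact continuous_quot_lift (f := fun φ => ((shiftHomeo φ : scrH) : scrH ⧸ G)) _
      (continuous_quotient_mk'.comp shiftHomeo.continuous)
  · exact continuous_quot_lift (f := fun φ => ((shiftHomeo.symm φ : scrH) : scrH ⧸ G)) _
      (continuous_quotient_mk'.comp shiftHomeo.symm.continuous)
  · rw [← shiftT_one_mul]
    rfl

end ScrH

theorem mainTheorem7 :
    -- The kernel `𝓚` of the action of `𝓗` on a Hausdorff quotient `𝓗 / 𝓖`.
    (∀ G : Subgroup scrH, T2Space (scrH ⧸ G) →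
      (∀ m : ℕ, IsLeast {m : ℕ | 1 ≤ m ∧ rho m ⁻¹' (rho m '' (G : Set scrH)) = G} m →
        (actionKernel G : Set scrH) = {φ | φ ∈ G ∧ ∀ k < m, φ.1 k = zeroTilde k}) ∧
      ((∀ m : ℕ, 1 ≤ m → (G : Set scrH) ⊂ rho m ⁻¹' (rho m '' (G : Set scrH))) →
        (actionKernel G : Set scrH) = {φ | φ.1 = zeroTilde})) ∧
    -- Every factor `(X, s)` of `(𝓗, T)` gives such a `𝓖`, and its Ellis group is `𝓗 / 𝓚`.
    (∀ (X : Type u) [TopologicalSpace X] [CompactSpace X] [T2Space X] (s : X ≃ₜ X) (p : scrH → X),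
      Continuous p → Function.Surjective p → (∀ φ, p (shiftT φ) = s (p φ)) →
      ∃ G : Subgroup scrH, (G : Set scrH) = {φ | p φ = p 1} ∧ T2Space (scrH ⧸ G) ∧
        ∃ e : (scrH ⧸ actionKernel G) ≃ₜ envelopingSemigroup s,
          (∀ a b : scrH ⧸ actionKernel G, (e (a * b)).1 = (e a).1 ∘ (e b).1) ∧
          ∀ φ ψ : scrH, (e (φ : scrH ⧸ actionKernel G)).1 (p ψ) = p (φ * ψ)) ∧
    -- Every such `𝓖` arises from a factor: `𝓗 / 𝓖` is a factor of `(𝓗, T)` by the quotient map.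
    (∀ G : Subgroup scrH, T2Space (scrH ⧸ G) →
      CompactSpace (scrH ⧸ G) ∧
      ∃ s : (scrH ⧸ G) ≃ₜ (scrH ⧸ G),
        ∀ φ : scrH, (shiftT φ : scrH ⧸ G) = s (φ : scrH ⧸ G)) := by
  refine ⟨fun G hG => ⟨fun m hm => ScrH.actionKernel_eq_of_isLeast hm,
    ScrH.actionKernel_eq_one⟩, ?_, fun G _ => ⟨inferInstance, ScrH.exists_homeomorph_quotient G⟩⟩
  intro X _ _ _ s p hp hsurj hs
  exact ⟨ScrH.fibre hp hs, rfl, ScrH.t2Space_quotient_fibre hp hs,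
    ScrH.exists_homeomorph_envelopingSemigroup hp hs hsurj⟩
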